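/- Let $\mathbb X,\mathbb Y$ be finite-dimensional real normed spaces with dual spaces $\mathbb X^*,\mathbb Y^*$ (dual norms $\|\cdot\|_*$), let $\mathsf A:\mathbb X\to\mathbb Y^*$ be linear with adjoint $\mathsf A^*:\mathbb Y\to\mathbb X^*$, let $f:\mathbb Y^*\to\mathbb R$ be convex and globally Lipschitz, and let $h:\mathbb X\to\mathbb R\cup\{+\infty\}$ be proper, closed and convex. Put $P(x)=f(\mathsf Ax)+h(x)$ and assume $\inf_x P(x)>-\infty$. With Fenchel conjugates $h^*:\mathbb X^*\to\mathbb R\cup\{+\infty\}$ and $f^*:\mathbb Y\to\mathbb R\cup\{+\infty\}$, put $D(y)=h^*(-\mathsf A^*y)+f^*(y)$ and $D_*=\inf_y D(y)$. Assume: (1) for every nonempty convex compact $\mathcal S\subseteq\operatorname{dom}h$, $h$ is strongly convex on $\mathcal S$ with some positive modulus; $\mu_{\mathcal S}$ denotes the largest such modulus $$\mu_{\mathcal S}=\inf\Big\{\tfrac{\lambda h(x)+(1-\lambda)h(x')-h(\lambda x+(1-\lambda)x')}{(\lambda(1-\lambda)/2)\|x-x'\|^2}: x\neq x'\in\mathcal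 S,\ \lambda\in(0,1)\Big\},$$ with $\mu_{\mathcal S}=1$ if $\mathcal S$ is a singleton; (2) $\operatorname{dom}h^*$ is open. Let $\alpha_k=k+1$, $\beta_k=k(k+1)/2$, $\tau_k=\alpha_k/\beta_{k+1}$. The method (dual averaging with dual monotonicity) starts from $\bar s^0\in\operatorname{dom}D$, with $x^0\in\arg\min_x\langle\bar s^0,\mathsf Ax\rangle+h(x)$ and $g^0\in\partial f(\mathsf Ax^0)$. At iteration $k\ge0$ it sets $\hat s^k=(1-\tau_k)\bar s^k+\tau_kg^k$. If $D(\hat s^k)<D(\bar s^k)$, then $\bar s^{k+1}=\hat s^k$, $x^{k+1}\in\arg\min_x\langle\bar s^{k+1},\mathsf Ax\rangle+h(x)$ and $g^{k+1}\in\partial f(\mathsf Ax^{k+1})$; otherwise $(\bar s^{k+1},x^{k+1},g^{k+1})=(\bar s^k,x^k,g^k)$. Let $\mathcal U=-\mathsf A^*(\operatorname{cl}\operatorname{dom}f^*)$, $\bar{\mathcal U}=-\mathsf A^*\{y:D(y)\le D(\bar s^0)\}$, $\ell=\max\{\|u-u'\|_*:u\in\bar{\mathcal U},u'\in\mathcal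 U\}$, and let $\Delta$ be the $\|\cdot\|_*$-distance from $\bar{\mathcal U}$ to $\operatorname{bd}\operatorname{dom}h^*$ ($\Delta=+\infty$ if $\operatorname{dom}h^*=\mathbb X^*$). Fix $0<r<\Delta$, let $\bar{\mathcal U}(r)$ be the set of points of $\mathbb X^*$ at distance at most $r$ from $\bar{\mathcal U}$, and let $\mathcal V$ be any convex compact set with $\bar{\mathcal U}(r)\subseteq\mathcal V\subseteq\operatorname{dom}h^*$. For $\mathcal W\subseteq\mathbb X^*$ let $$K_{\mathcal W}=\min\{k\ge0:(1-\tau_k)u+\tau_ku'\in\mathcal W\ \ \forall u\in\bar{\mathcal U},\ \forall u'\in\mathcal U\},$$ write $K=K_{\mathcal V}$, and let $\mu=\mu_{\mathcal S}$ with $\mathcal S=\operatorname{conv}(\nabla h^*(\mathcal V))$. **Theorem.** The minima defining $K_{\mathcal V}$ and $K_{\bar{\mathcal U}(r)}$ exist, and $$K_{\mathcal V}\le K_{\bar{\mathcal U}(r)}\le 2\big\lceil(\ell/r-1)_+\big\rceil .$$ Moreover $\mu>0$, the method is well defined (it can be run indefinitely from $\bar s^0$), and every run of it satisfies: (a) $D(\bar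 s^{k+1})\le D(\bar s^k)$ for all $k\ge0$; in particular $D(\bar s^k)\le D(\bar s^0)$ for $1\le k\le K$. (b) For all $k\ge K+1$, $$\min_{0\le i\le k-1}\big(P(x^i)+D(\bar s^i)\big)\le\frac{12(K+1)^2}{(k-K)(k+K)}\big(D(\bar s^K)-D_*\big)+\frac{26\,\ell^2}{\mu\,(k+K)} .$$ (c) If $\hat x^k\in\arg\min_{x\in\{x^0,\dots,x^k\}}P(x)$ for all $k\ge0$, then for all $k\ge K+1$, $$P(\hat x^k)+D(\bar s^k)\le\frac{K(K+1)}{k(k+1)}\big(P(\hat x^K)+D(\bar s^K)\big)+\frac{2\,\ell^2\,(k-K)}{\mu\,k(k+1)} .$$ -/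

import Mathlib

open Set

noncomputable section

namespace DualAveraging

/-! Convex analysis for functions with values in the extended reals -/

/-- The effective domain `{x : φ x < +∞}`. -/
def effDom {E : Type*} (φ : E → EReal) : Set E := {x | φ x < ⊤}

/-- `φ` is proper, closed (lower semicontinuous) and convex (its epigraph is convex). -/
structure ProperClosedConvex {E : Type*} [NormedAddCommGroup E] [NormedSpace ℝ E]
    (φ : E → EReal) : Prop where
  ne_bot : ∀ x, φ x ≠ ⊥
  nonempty_dom : (effDom φ).Nonempty
  closed : LowerSemicontinuous φ
  convex : Convex ℝ {p : E × ℝ | φ p.1 ≤ (p.2 : EReal)}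

/-- Fenchel conjugate `h*(u) = sup_x ⟨u, x⟩ - h x` on the dual space, for `h` defined on `X`. -/
def conj {X : Type*} [NormedAddCommGroup X] [NormedSpace ℝ X]
    (h : X → EReal) (u : StrongDual ℝ X) : EReal :=
  ⨆ x : X, ((u x : ℝ) : EReal) - h x

/-- Fenchel conjugate `f*(y) = sup_z ⟨z, y⟩ - f z` for a real function `f` on the dual space `Y*`;
the bidual of the finite-dimensional space `Y` is identified with `Y`. -/
def conjOfDual {Y : Type*} [NormedAddCommGroup Y] [NormedSpace ℝ Y]
    (f : StrongDual ℝ Y → ℝ) (y : Y) : EReal :=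
  ⨆ z : StrongDual ℝ Y, ((z y - f z : ℝ) : EReal)

/-- The subdifferential `∂f(z) ⊆ Y` of a real function `f` on the dual space `Y*`. -/
def subdiff {Y : Type*} [NormedAddCommGroup Y] [NormedSpace ℝ Y]
    (f : StrongDual ℝ Y → ℝ) (z : StrongDual ℝ Y) : Set Y :=
  {y | ∀ z' : StrongDual ℝ Y, f z + (z' - z) y ≤ f z'}

/-- The image `∇h*(W) ⊆ X`: the gradient of `h*` at `u` is the vector `x` for which the
derivative of `h*` at `u` is `v ↦ ⟨v, x⟩`. -/
def gradConjImage {X : Type*} [NormedAddCommGroup X] [NormedSpace ℝ X]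
    (h : X → EReal) (W : Set (StrongDual ℝ X)) : Set X :=
  {x | ∃ u ∈ W, HasFDerivAt (fun v : StrongDual ℝ X => (conj h v).toReal)
    (NormedSpace.inclusionInDoubleDual ℝ X x) u}

/-- `h` is strongly convex, with some positive modulus, on every nonempty convex compact subset
of its domain. -/
def LocallyStronglyConvex {X : Type*} [NormedAddCommGroup X] [NormedSpace ℝ X]
    (h : X → EReal) : Prop :=
  ∀ S : Set X, S.Nonempty → Convex ℝ S → IsCompact S → S ⊆ effDom h →
    ∃ μ : ℝ, 0 < μ ∧ StrongConvexOn S μ (fun x => (h x).toReal)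

open Classical in
/-- The tightest modulus `μ_S` of strong convexity of `h` on `S ⊆ dom h`, with `μ_S = 1` for
a singleton. -/
def modulus {X : Type*} [NormedAddCommGroup X] [NormedSpace ℝ X]
    (h : X → EReal) (S : Set X) : ℝ :=
  if S.Subsingleton then 1
  else sInf {m : ℝ | ∃ x ∈ S, ∃ x' ∈ S, ∃ t ∈ Ioo (0 : ℝ) 1, x ≠ x' ∧
    m = (t * (h x).toReal + (1 - t) * (h x').toReal - (h (t • x + (1 - t) • x')).toReal) /
      (t * (1 - t) / 2 * ‖x' - x‖ ^ 2)}

/-! Step sizes -/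

def α (k : ℕ) : ℝ := (k : ℝ) + 1

def β (k : ℕ) : ℝ := (k : ℝ) * ((k : ℝ) + 1) / 2

def τ (k : ℕ) : ℝ := α k / β (k + 1)

/-! The primal and dual problems -/

/-- The primal objective `P x = f (A x) + h x`. -/
def primal {X Y : Type*} [NormedAddCommGroup X] [NormedSpace ℝ X]
    [NormedAddCommGroup Y] [NormedSpace ℝ Y]
    (f : StrongDual ℝ Y → ℝ) (h : X → EReal) (A : X →L[ℝ] StrongDual ℝ Y) (x : X) : EReal :=
  (f (A x) : EReal) + h x

/-- The dual objective `D y = h*(-A* y) + f* y`; the adjoint `A* : Y → X*` is `A.flip`. -/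
def dual {X Y : Type*} [NormedAddCommGroup X] [NormedSpace ℝ X]
    [NormedAddCommGroup Y] [NormedSpace ℝ Y]
    (f : StrongDual ℝ Y → ℝ) (h : X → EReal) (A : X →L[ℝ] StrongDual ℝ Y) (y : Y) : EReal :=
  conj h (-(A.flip y)) + conjOfDual f y

/-- The optimal dual value `D_* = inf_y D y`. -/
def dualOpt {X Y : Type*} [NormedAddCommGroup X] [NormedSpace ℝ X]
    [NormedAddCommGroup Y] [NormedSpace ℝ Y]
    (f : StrongDual ℝ Y → ℝ) (h : X → EReal) (A : X →L[ℝ] StrongDual ℝ Y) : EReal :=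
  ⨅ y : Y, dual f h A y

/-! Dual averaging with dual monotonicity -/

/-- `x` minimizes `⟨s, A x⟩ + h x` over `X`. -/
def IsProxMin {X Y : Type*} [NormedAddCommGroup X] [NormedSpace ℝ X]
    [NormedAddCommGroup Y] [NormedSpace ℝ Y]
    (h : X → EReal) (A : X →L[ℝ] StrongDual ℝ Y) (s : Y) (x : X) : Prop :=
  ∀ x' : X, ((A x s : ℝ) : EReal) + h x ≤ ((A x' s : ℝ) : EReal) + h x'

/-- The sequences `s`, `x`, `g` (the iterates `s̄^k`, `x^k`, `g^k`) are produced by the dual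
averaging method with dual monotonicity started at `s0`. -/
structure IsRun {X Y : Type*} [NormedAddCommGroup X] [NormedSpace ℝ X]
    [NormedAddCommGroup Y] [NormedSpace ℝ Y]
    (f : StrongDual ℝ Y → ℝ) (h : X → EReal) (A : X →L[ℝ] StrongDual ℝ Y) (s0 : Y)
    (s : ℕ → Y) (x : ℕ → X) (g : ℕ → Y) : Prop where
  s_zero : s 0 = s0
  x_zero : IsProxMin h A (s 0) (x 0)
  g_zero : g 0 ∈ subdiff f (A (x 0))
  active : ∀ k, dual f h A ((1 - τ k) • s k + τ k • g k) < dual f h A (s k) →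
    s (k + 1) = (1 - τ k) • s k + τ k • g k ∧
    IsProxMin h A (s (k + 1)) (x (k + 1)) ∧
    g (k + 1) ∈ subdiff f (A (x (k + 1)))
  idle : ∀ k, ¬ dual f h A ((1 - τ k) • s k + τ k • g k) < dual f h A (s k) →
    s (k + 1) = s k ∧ x (k + 1) = x k ∧ g (k + 1) = g k

/-! Geometric quantities -/

/-- `U = -A*(cl dom f*)`. -/
def U {X Y : Type*} [NormedAddCommGroup X] [NormedSpace ℝ X]
    [NormedAddCommGroup Y] [NormedSpace ℝ Y]
    (f : StrongDual ℝ Y → ℝ) (A : X →L[ℝ] StrongDual ℝ Y) : Set (StrongDual ℝ X) :=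
  (fun y => -(A.flip y)) '' closure (effDom (conjOfDual f))

/-- `Ū = -A*(L)`, where `L = {y : D y ≤ D s0}` is the initial dual sublevel set. -/
def Ubar {X Y : Type*} [NormedAddCommGroup X] [NormedSpace ℝ X]
    [NormedAddCommGroup Y] [NormedSpace ℝ Y]
    (f : StrongDual ℝ Y → ℝ) (h : X → EReal) (A : X →L[ℝ] StrongDual ℝ Y) (s0 : Y) :
    Set (StrongDual ℝ X) :=
  (fun y => -(A.flip y)) '' {y | dual f h A y ≤ dual f h A s0}

/-- `Δ`, the distance from `Ū` to the boundary of `dom h*`; it is `+∞` if that boundary is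
empty. -/
def Delta {X Y : Type*} [NormedAddCommGroup X] [NormedSpace ℝ X]
    [NormedAddCommGroup Y] [NormedSpace ℝ Y]
    (f : StrongDual ℝ Y → ℝ) (h : X → EReal) (A : X →L[ℝ] StrongDual ℝ Y) (s0 : Y) : ENNReal :=
  ⨅ u ∈ Ubar f h A s0, ⨅ u' ∈ frontier (effDom (conj h)), edist u u'

/-- `ℓ(Ū, U)`, the furthest distance between `Ū` and `U`. -/
def ell {X Y : Type*} [NormedAddCommGroup X] [NormedSpace ℝ X]
    [NormedAddCommGroup Y] [NormedSpace ℝ Y]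
    (f : StrongDual ℝ Y → ℝ) (h : X → EReal) (A : X →L[ℝ] StrongDual ℝ Y) (s0 : Y) : ℝ :=
  sSup {d : ℝ | ∃ u ∈ Ubar f h A s0, ∃ u' ∈ U f A, d = ‖u - u'‖}

/-- The indices `k` with `(1 - τ_k) u + τ_k u' ∈ V` for all `u ∈ Ū` and `u' ∈ U`. -/
def burnInSet {X Y : Type*} [NormedAddCommGroup X] [NormedSpace ℝ X]
    [NormedAddCommGroup Y] [NormedSpace ℝ Y]
    (f : StrongDual ℝ Y → ℝ) (h : X → EReal) (A : X →L[ℝ] StrongDual ℝ Y) (s0 : Y)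
    (V : Set (StrongDual ℝ X)) : Set ℕ :=
  {k | ∀ u ∈ Ubar f h A s0, ∀ u' ∈ U f A, (1 - τ k) • u + τ k • u' ∈ V}

/-- The burn-in length `K_V`, the least element of `burnInSet`. -/
def burnIn {X Y : Type*} [NormedAddCommGroup X] [NormedSpace ℝ X]
    [NormedAddCommGroup Y] [NormedSpace ℝ Y]
    (f : StrongDual ℝ Y → ℝ) (h : X → EReal) (A : X →L[ℝ] StrongDual ℝ Y) (s0 : Y)
    (V : Set (StrongDual ℝ X)) : ℕ :=
  sInf (burnInSet f h A s0 V)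

/-- `S = conv (∇h*(V))`. -/
def primalHull {X : Type*} [NormedAddCommGroup X] [NormedSpace ℝ X]
    (h : X → EReal) (V : Set (StrongDual ℝ X)) : Set X :=
  convexHull ℝ (gradConjImage h V)

end DualAveraging

end

/-!
The proof has a smoothness half and a recursive half.

*Smoothness of `h*`.* On the open set `dom h*` the finite convex function `h*` is continuous, and
finiteness near `u` forces `h - u` to grow linearly, so near-maximizers of `⟨u, ·⟩ - h` are
relatively compact (`ProperClosedConvex.exists_subseq_argmax`). Hence maximizers exist; by strict
convexity of `h` they are unique and depend continuously on `u`, and they are the gradients of `h*`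
(`IsConjArgmax.hasFDerivAt`). Over the compact set `V` the gradients are bounded with bounded
`h`-values, so the closure of their convex hull is a compact convex subset of `dom h`
(`exists_compact_primalHull_subset`). Strong convexity there makes the modulus `μ` positive
(`modulus_spec`), and dually gives on `V` the descent inequality
`h* v ≤ h* u + ⟨v - u, ∇h* u⟩ + ‖v - u‖² / (2 μ)` (`conj_le_of_strong`).

*One step.* From index `K` on, the point `-A* ŝ^k` stays in `V`. Fenchel–Young equality at `x^k`
and `g^k` identifies the linear term of the descent inequality, combined with convexity of `f*`,
with the primal-dual gap `G_k = P (x^k) + D (s̄^k)`; this yields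
`D (s̄^{k+1}) ≤ D (s̄^k) - τ_k G_k + τ_k² C` with `C = ℓ² / (2 μ)` (`IsRun.dual_succ_le_sub_gap`).

*Rates.* Since `τ_k = 2 / (k + 2)`, a recursion `e_{k+1} ≤ (1 - τ_k) e_k + τ_k² C` telescopes after
multiplication by `(k + 1) (k + 2)` (`mul_le_of_recursion`). For the best primal iterate,
`e_k = P (x̂^k) + D (s̄^k)` satisfies it directly. For the smallest gap, weak duality
gives `D (s̄^k) - D_* ≤ G_k`, so `e_k = D (s̄^k) - D_*` satisfies it as well; summing the one-step
inequality over the second half of `[K, k)` then bounds the smallest gap (`exists_gap_le`).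
-/

namespace DualAveraging

open Filter Topology

/-! ### Conjugates in terms of real numbers -/

section ConjX

variable {X : Type*} [NormedAddCommGroup X] [NormedSpace ℝ X] {h : X → EReal}

lemma ProperClosedConvex.coe_toReal (hh : ProperClosedConvex h) {x : X} (hx : x ∈ effDom h) :
    ((h x).toReal : EReal) = h x :=
  EReal.coe_toReal (ne_of_lt hx) (hh.ne_bot x)

lemma ProperClosedConvex.conj_ne_bot (hh : ProperClosedConvex h) (u : StrongDual ℝ X) :
    conj h u ≠ ⊥ := by
  obtain ⟨x, hx⟩ := hh.nonempty_dom
  have h1 : ((u x : ℝ) : EReal) - h x ≤ conj h u := le_iSup (fun x => ((u x : ℝ) : EReal) - h x) x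
  rw [← hh.coe_toReal hx, ← EReal.coe_sub] at h1
  exact ne_bot_of_le_ne_bot (EReal.coe_ne_bot _) h1

lemma ProperClosedConvex.coe_toReal_conj (hh : ProperClosedConvex h) {u : StrongDual ℝ X}
    (hu : u ∈ effDom (conj h)) : ((conj h u).toReal : EReal) = conj h u :=
  EReal.coe_toReal (ne_of_lt hu) (hh.conj_ne_bot u)

lemma ProperClosedConvex.sub_le_conj (hh : ProperClosedConvex h) {u : StrongDual ℝ X}
    (hu : u ∈ effDom (conj h)) {x : X} (hx : x ∈ effDom h) :
    u x - (h x).toReal ≤ (conj h u).toReal := by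
  have h1 : ((u x : ℝ) : EReal) - h x ≤ conj h u := le_iSup (fun x => ((u x : ℝ) : EReal) - h x) x
  rw [← hh.coe_toReal hx, ← EReal.coe_sub, ← hh.coe_toReal_conj hu] at h1
  exact_mod_cast h1

lemma ProperClosedConvex.conj_le (hh : ProperClosedConvex h) {u : StrongDual ℝ X} {c : ℝ}
    (hc : ∀ x ∈ effDom h, u x - (h x).toReal ≤ c) : conj h u ≤ c := by
  refine iSup_le fun x => ?_
  by_cases hx : x ∈ effDom h
  · rw [← hh.coe_toReal hx, ← EReal.coe_sub]
    exact_mod_cast hc x hx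
  · have : h x = ⊤ := by simpa [effDom] using hx
    rw [this]; simp

lemma ProperClosedConvex.mem_dom_conj (hh : ProperClosedConvex h) {u : StrongDual ℝ X} {c : ℝ}
    (hc : ∀ x ∈ effDom h, u x - (h x).toReal ≤ c) :
    u ∈ effDom (conj h) ∧ (conj h u).toReal ≤ c := by
  have h1 := hh.conj_le hc
  have h2 : u ∈ effDom (conj h) := lt_of_le_of_lt h1 (EReal.coe_lt_top c)
  refine ⟨h2, ?_⟩
  rw [← hh.coe_toReal_conj h2] at h1
  exact_mod_cast h1

lemma ProperClosedConvex.convex_sublevel (hh : ProperClosedConvex h) (c : ℝ) :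
    Convex ℝ {x | h x ≤ c} := by
  intro x hx y hy a b ha hb hab
  have := hh.convex (x := (x, c)) hx (y := (y, c)) hy ha hb hab
  have h2 : a * c + b * c = c := by rw [← add_mul, hab, one_mul]
  simpa [h2] using this

lemma ProperClosedConvex.isClosed_sublevel (hh : ProperClosedConvex h) (c : ℝ) :
    IsClosed {x | h x ≤ c} :=
  hh.closed.isClosed_preimage _

lemma ProperClosedConvex.convex_effDom (hh : ProperClosedConvex h) : Convex ℝ (effDom h) := by
  intro x hx y hy a b ha hb hab
  have h1 : x ∈ {x | h x ≤ ((max (h x).toReal (h y).toReal : ℝ) : EReal)} := by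
    rw [mem_ofPred_eq, ← hh.coe_toReal hx]; exact_mod_cast le_max_left _ _
  have h2 : y ∈ {z | h z ≤ ((max (h x).toReal (h y).toReal : ℝ) : EReal)} := by
    rw [mem_ofPred_eq, ← hh.coe_toReal hy]; exact_mod_cast le_max_right _ _
  exact lt_of_le_of_lt (hh.convex_sublevel _ h1 h2 ha hb hab) (EReal.coe_lt_top _)

lemma ProperClosedConvex.convexOn_conj (hh : ProperClosedConvex h) :
    ConvexOn ℝ (effDom (conj h)) (fun u => (conj h u).toReal) := by
  have key : ∀ u ∈ effDom (conj h), ∀ v ∈ effDom (conj h), ∀ a b : ℝ, 0 ≤ a → 0 ≤ b → a + b = 1 →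
      ∀ x ∈ effDom h, (a • u + b • v) x - (h x).toReal ≤
        a * (conj h u).toReal + b * (conj h v).toReal := by
    intro u hu v hv a b ha hb hab x hx
    have h1 := mul_le_mul_of_nonneg_left (hh.sub_le_conj hu hx) ha
    have h2 := mul_le_mul_of_nonneg_left (hh.sub_le_conj hv hx) hb
    have h3 : (h x).toReal = a * (h x).toReal + b * (h x).toReal := by
      rw [← add_mul, hab, one_mul]
    simp only [add_apply, smul_apply, smul_eq_mul]
    linarith
  refine ⟨fun u hu v hv a b ha hb hab => (hh.mem_dom_conj (key u hu v hv a b ha hb hab)).1,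
    fun u hu v hv a b ha hb hab => ?_⟩
  simpa using (hh.mem_dom_conj (key u hu v hv a b ha hb hab)).2

/-! ### Maximizers and the gradient of `h*` -/

/-- `x` attains the supremum defining `h*(u)`, in real terms: `x ∈ dom h` maximizes
`x' ↦ ⟨u, x'⟩ - h x'` over `dom h`. -/
def IsConjArgmax (h : X → EReal) (u : StrongDual ℝ X) (x : X) : Prop :=
  x ∈ effDom h ∧ ∀ x' ∈ effDom h, u x' - (h x').toReal ≤ u x - (h x).toReal

lemma IsConjArgmax.mem_dom_conj (hh : ProperClosedConvex h) {u : StrongDual ℝ X} {x : X}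
    (hx : IsConjArgmax h u x) : u ∈ effDom (conj h) :=
  (hh.mem_dom_conj hx.2).1

lemma IsConjArgmax.conj_eq (hh : ProperClosedConvex h) {u : StrongDual ℝ X} {x : X}
    (hx : IsConjArgmax h u x) : (conj h u).toReal = u x - (h x).toReal :=
  le_antisymm (hh.mem_dom_conj hx.2).2 (hh.sub_le_conj (hx.mem_dom_conj hh) hx.1)

/-- Strong convexity of `h` on segments of `dom h` makes `h` strictly convex there. -/
lemma IsConjArgmax.unique (hh : ProperClosedConvex h) (hsc : LocallyStronglyConvex h)
    {u : StrongDual ℝ X} {x y : X} (hx : IsConjArgmax h u x) (hy : IsConjArgmax h u y) : x = y := by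
  by_contra hne
  obtain ⟨m, hm, hS⟩ := hsc (segment ℝ x y) ⟨x, left_mem_segment ℝ x y⟩ (convex_segment x y)
    (by rw [segment_eq_image_lineMap]; exact isCompact_Icc.image (AffineMap.lineMap_continuous))
    (hh.convex_effDom.segment_subset hx.1 hy.1)
  obtain ⟨-, hS⟩ := hS
  have h1 := hS (left_mem_segment ℝ x y) (right_mem_segment ℝ x y) (a := 1 / 2) (b := 1 / 2)
    (by norm_num) (by norm_num) (by norm_num)
  have hmid : (1 / 2 : ℝ) • x + (1 / 2 : ℝ) • y ∈ effDom h :=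
    hh.convex_effDom hx.1 hy.1 (by norm_num) (by norm_num) (by norm_num)
  have h2 := hx.2 _ hmid
  have h3 := hy.2 _ hx.1
  have h4 : 0 < m / 2 * ‖x - y‖ ^ 2 := by
    have : 0 < ‖x - y‖ := norm_pos_iff.2 (sub_ne_zero.2 hne)
    positivity
  simp only [smul_eq_mul, map_add, map_smul] at h1 h2
  linarith [hx.2 _ hy.1]

variable [FiniteDimensional ℝ X]

lemma ProperClosedConvex.continuousOn_conj (hh : ProperClosedConvex h)
    (hopen : IsOpen (effDom (conj h))) :
    ContinuousOn (fun u => (conj h u).toReal) (effDom (conj h)) :=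
  hh.convexOn_conj.continuousOn hopen

/-- If `dom h*` is open, the near-maximizers of `⟨u, ·⟩ - h` stay bounded as `u` stays close to a
point of `dom h*`: finiteness of `h*` around the point forces linear growth of `h - u`. -/
lemma ProperClosedConvex.exists_ball_bound (hh : ProperClosedConvex h)
    (hopen : IsOpen (effDom (conj h))) {u₀ : StrongDual ℝ X} (hu₀ : u₀ ∈ effDom (conj h)) :
    ∃ ε > 0, ∃ R : ℝ, ∀ u ∈ Metric.ball u₀ ε, ∀ x ∈ effDom h,
      (conj h u).toReal - 1 ≤ u x - (h x).toReal → ‖x‖ ≤ R := by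
  have hc := (hh.continuousOn_conj hopen).continuousAt (hopen.mem_nhds hu₀)
  have hev : ∀ᶠ u in 𝓝 u₀, u ∈ effDom (conj h) ∧
      |(conj h u).toReal - (conj h u₀).toReal| < 1 := by
    refine Filter.Eventually.and (hopen.mem_nhds hu₀) ?_
    have := Metric.tendsto_nhds.1 hc 1 one_pos
    simpa [Real.dist_eq] using this
  obtain ⟨ε, hε, hball⟩ := Metric.eventually_nhds_iff.1 hev
  refine ⟨ε / 2, by positivity, 3 / (ε / 2), fun u hu x hx hxu => ?_⟩
  obtain ⟨g, hg, hgx⟩ := exists_dual_vector'' ℝ x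
  have hu' : dist u u₀ < ε / 2 := hu
  have h1 := (hball (show dist u u₀ < ε by linarith)).2
  -- moving `u` by `ε / 2` in the direction of a norming functional of `x`
  have hd : dist (u + (ε / 2) • g) u₀ < ε := by
    have h5 : dist (u + (ε / 2) • g) u ≤ ε / 2 := by
      rw [dist_eq_norm, add_sub_cancel_left, norm_smul, Real.norm_of_nonneg (by positivity)]
      exact mul_le_of_le_one_right (by positivity) hg
    linarith [dist_triangle (u + (ε / 2) • g) u u₀]
  obtain ⟨h2, h3⟩ := hball hd
  have h4 := hh.sub_le_conj h2 hx
  rw [abs_lt] at h1 h3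
  simp only [add_apply, smul_apply, smul_eq_mul, hgx] at h4
  rw [le_div_iff₀ (by positivity)]
  simp only [RCLike.ofReal_real_eq_id, id_eq] at h4
  linarith

/-- Compactness of near-maximizers: along `u n → u₀ ∈ dom h*`, any sequence of `δ n`-maximizers
with `δ n → 0` has a subsequence converging to a maximizer at `u₀`. -/
lemma ProperClosedConvex.exists_subseq_argmax (hh : ProperClosedConvex h)
    (hopen : IsOpen (effDom (conj h))) {u₀ : StrongDual ℝ X} (hu₀ : u₀ ∈ effDom (conj h))
    {u : ℕ → StrongDual ℝ X} (hu : Tendsto u atTop (𝓝 u₀)) {x : ℕ → X}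
    (hx : ∀ n, x n ∈ effDom h) {δ : ℕ → ℝ} (hδ : Tendsto δ atTop (𝓝 0))
    (hxu : ∀ n, (conj h (u n)).toReal - δ n ≤ u n (x n) - (h (x n)).toReal) :
    ∃ x₀, IsConjArgmax h u₀ x₀ ∧ ∃ φ : ℕ → ℕ, StrictMono φ ∧
      Tendsto (x ∘ φ) atTop (𝓝 x₀) := by
  obtain ⟨ε, hε, R, hR⟩ := hh.exists_ball_bound hopen hu₀
  have hbd : ∀ᶠ n in atTop, x n ∈ Metric.closedBall (0 : X) R := by
    filter_upwards [hu (Metric.ball_mem_nhds u₀ hε), hδ (gt_mem_nhds one_pos)] with n h1 h2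
    rw [mem_closedBall_zero_iff]
    have h2' : δ n < 1 := h2
    exact hR _ h1 _ (hx n) (by linarith [hxu n])
  obtain ⟨x₀, -, φ, hφ, hlim⟩ :=
    tendsto_subseq_of_frequently_bounded Metric.isBounded_closedBall hbd.frequently
  have hφt := hφ.tendsto_atTop
  have huφ : Tendsto (fun n => u (φ n)) atTop (𝓝 u₀) := hu.comp hφt
  have hux : Tendsto (fun n => u (φ n) (x (φ n))) atTop (𝓝 (u₀ x₀)) :=
    (isBoundedBilinearMap_apply.continuous.tendsto (u₀, x₀)).comp (huφ.prodMk_nhds hlim)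
  have hcu : Tendsto (fun n => (conj h (u (φ n))).toReal) atTop (𝓝 (conj h u₀).toReal) :=
    ((hh.continuousOn_conj hopen).continuousAt (hopen.mem_nhds hu₀)).tendsto.comp huφ
  have hc : Tendsto (fun n => u (φ n) (x (φ n)) - (conj h (u (φ n))).toReal + δ (φ n)) atTop
      (𝓝 (u₀ x₀ - (conj h u₀).toReal)) := by
    simpa using (hux.sub hcu).add (hδ.comp hφt)
  have hmem : h x₀ ≤ ((u₀ x₀ - (conj h u₀).toReal : ℝ) : EReal) := by
    have hcl : IsClosed {p : X × EReal | h p.1 ≤ p.2} := hh.closed.isClosed_epigraph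
    suffices hp : (x₀, ((u₀ x₀ - (conj h u₀).toReal : ℝ) : EReal)) ∈
        {p : X × EReal | h p.1 ≤ p.2} from hp
    refine hcl.mem_of_tendsto (b := atTop) (f := fun n => ((x (φ n),
      ((u (φ n) (x (φ n)) - (conj h (u (φ n))).toReal + δ (φ n) : ℝ) : EReal)) : X × EReal))
      (hlim.prodMk_nhds ((continuous_coe_real_ereal.tendsto _).comp hc)) (Eventually.of_forall ?_)
    intro n
    rw [mem_ofPred_eq, ← hh.coe_toReal (hx _)]
    exact EReal.coe_le_coe_iff.2 (by linarith [hxu (φ n)])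
  have hx₀ : x₀ ∈ effDom h := lt_of_le_of_lt hmem (EReal.coe_lt_top _)
  refine ⟨x₀, ⟨hx₀, fun x' hx' => ?_⟩, φ, hφ, hlim⟩
  rw [← hh.coe_toReal hx₀] at hmem
  have hmem' : (h x₀).toReal ≤ u₀ x₀ - (conj h u₀).toReal := by exact_mod_cast hmem
  linarith [hh.sub_le_conj hu₀ hx']

lemma ProperClosedConvex.exists_argmax (hh : ProperClosedConvex h)
    (hopen : IsOpen (effDom (conj h))) {u : StrongDual ℝ X} (hu : u ∈ effDom (conj h)) :
    ∃ x, IsConjArgmax h u x := by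
  have hex : ∀ n : ℕ, ∃ x ∈ effDom h,
      (conj h u).toReal - 1 / ((n : ℝ) + 1) ≤ u x - (h x).toReal := by
    intro n
    by_contra! hcon
    have := (hh.mem_dom_conj fun x hx => (hcon x hx).le).2
    have : 0 < 1 / ((n : ℝ) + 1) := by positivity
    linarith
  choose x hx hxu using hex
  obtain ⟨x₀, hx₀, -⟩ := hh.exists_subseq_argmax hopen hu tendsto_const_nhds hx
    tendsto_one_div_add_atTop_nhds_zero_nat hxu
  exact ⟨x₀, hx₀⟩

lemma ProperClosedConvex.exists_argmax_selection (hh : ProperClosedConvex h)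
    (hopen : IsOpen (effDom (conj h))) :
    ∃ ξ : StrongDual ℝ X → X, ∀ u ∈ effDom (conj h), IsConjArgmax h u (ξ u) := by
  have hex : ∀ u : StrongDual ℝ X, ∃ x, u ∈ effDom (conj h) → IsConjArgmax h u x := fun u => by
    by_cases hu : u ∈ effDom (conj h)
    · exact (hh.exists_argmax hopen hu).imp fun x hx _ => hx
    · exact ⟨0, fun h => absurd h hu⟩
  choose ξ hξ using hex
  exact ⟨ξ, hξ⟩

/-- Any selection of maximizers over `dom h*` is continuous, by compactness and uniqueness. -/
lemma ProperClosedConvex.continuousOn_argmax (hh : ProperClosedConvex h)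
    (hopen : IsOpen (effDom (conj h))) (hsc : LocallyStronglyConvex h)
    {ξ : StrongDual ℝ X → X} (hξ : ∀ u ∈ effDom (conj h), IsConjArgmax h u (ξ u)) :
    ContinuousOn ξ (effDom (conj h)) := by
  intro u₀ hu₀
  refine tendsto_of_subseq_tendsto fun us hus => ?_
  obtain ⟨hus1, hus2⟩ := tendsto_nhdsWithin_iff.1 hus
  obtain ⟨N, hN⟩ := eventually_atTop.1 hus2
  have hu' : ∀ n, us (n + N) ∈ effDom (conj h) := fun n => hN _ (by omega)
  obtain ⟨x₀, hx₀, φ, -, hlim⟩ := hh.exists_subseq_argmax hopen hu₀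
    (u := fun n => us (n + N)) (hus1.comp (tendsto_add_atTop_nat N))
    (x := fun n => ξ (us (n + N))) (fun n => (hξ _ (hu' n)).1) (δ := fun _ => 0)
    tendsto_const_nhds (fun n => by rw [(hξ _ (hu' n)).conj_eq hh]; simp)
  refine ⟨fun n => φ n + N, ?_⟩
  rw [(hξ _ hu₀).unique hh hsc hx₀]
  exact hlim

/-- `h*` is differentiable on its open domain, with the maximizer as gradient. -/
lemma IsConjArgmax.hasFDerivAt (hh : ProperClosedConvex h)
    (hopen : IsOpen (effDom (conj h))) (hsc : LocallyStronglyConvex h)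
    {u₀ : StrongDual ℝ X} {x₀ : X} (hx₀ : IsConjArgmax h u₀ x₀) :
    HasFDerivAt (fun v : StrongDual ℝ X => (conj h v).toReal)
      (NormedSpace.inclusionInDoubleDual ℝ X x₀) u₀ := by
  have hu₀ := hx₀.mem_dom_conj hh
  obtain ⟨ξ, hξ⟩ := hh.exists_argmax_selection hopen
  have hcont := (hh.continuousOn_argmax hopen hsc hξ).continuousAt (hopen.mem_nhds hu₀)
  rw [hasFDerivAt_iff_isLittleO, Asymptotics.isLittleO_iff]
  intro c hc
  filter_upwards [hopen.mem_nhds hu₀, Metric.tendsto_nhds.1 hcont c hc] with u hu hcu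
  rw [(hξ _ hu₀).unique hh hsc hx₀, dist_eq_norm] at hcu
  have h1 := hh.sub_le_conj hu hx₀.1
  have h2 := hh.sub_le_conj hu₀ (hξ u hu).1
  have h3 := (hξ u hu).conj_eq hh
  have h4 := hx₀.conj_eq hh
  have h5 : (u - u₀) (ξ u - x₀) ≤ c * ‖u - u₀‖ := by
    calc (u - u₀) (ξ u - x₀) ≤ ‖(u - u₀) (ξ u - x₀)‖ := Real.le_norm_self _
      _ ≤ ‖u - u₀‖ * ‖ξ u - x₀‖ := (u - u₀).le_opNorm _
      _ ≤ c * ‖u - u₀‖ := by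
        rw [mul_comm]; exact mul_le_mul_of_nonneg_right hcu.le (norm_nonneg _)
  simp only [NormedSpace.dual_def, sub_apply, map_sub] at h5 ⊢
  rw [Real.norm_eq_abs, abs_le]
  have h6 : 0 ≤ c * ‖u - u₀‖ := by positivity
  constructor <;> linarith

lemma gradConjImage_eq (hh : ProperClosedConvex h)
    (hopen : IsOpen (effDom (conj h))) (hsc : LocallyStronglyConvex h)
    {V : Set (StrongDual ℝ X)} (hV : V ⊆ effDom (conj h)) :
    gradConjImage h V = {x | ∃ u ∈ V, IsConjArgmax h u x} := by
  ext x
  constructor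
  · rintro ⟨u, hu, hd⟩
    obtain ⟨x', hx'⟩ := hh.exists_argmax hopen (hV hu)
    have heq := hd.unique (hx'.hasFDerivAt hh hopen hsc)
    have : x = x' := (NormedSpace.inclusionInDoubleDualLi ℝ (E := X)).injective heq
    exact ⟨u, hu, this ▸ hx'⟩
  · rintro ⟨u, hu, hx⟩
    exact ⟨u, hu, hx.hasFDerivAt hh hopen hsc⟩

/-- The gradients over a compact subset of `dom h*` have their convex hull inside a compact convex
subset of `dom h`: they are bounded, and `h` is bounded above on them, hence on the closure of their
convex hull. -/
lemma exists_compact_primalHull_subset (hh : ProperClosedConvex h)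
    (hopen : IsOpen (effDom (conj h))) (hsc : LocallyStronglyConvex h)
    {V : Set (StrongDual ℝ X)} (hVc : IsCompact V) (hV : V ⊆ effDom (conj h)) :
    ∃ S, primalHull h V ⊆ S ∧ Convex ℝ S ∧ IsCompact S ∧ S ⊆ effDom h := by
  obtain ⟨ξ, hξ⟩ := hh.exists_argmax_selection hopen
  have hcont := (hh.continuousOn_argmax hopen hsc hξ).mono hV
  have hTeq : gradConjImage h V = ξ '' V := by
    rw [gradConjImage_eq hh hopen hsc hV]
    ext x
    constructor
    · rintro ⟨u, hu, hx⟩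
      exact ⟨u, hu, (hξ u (hV hu)).unique hh hsc hx⟩
    · rintro ⟨u, hu, rfl⟩
      exact ⟨u, hu, hξ u (hV hu)⟩
  have hT : IsCompact (gradConjImage h V) := hTeq ▸ hVc.image_of_continuousOn hcont
  have hval : ContinuousOn (fun u => u (ξ u) - (conj h u).toReal) V :=
    (continuousOn_id.clm_apply hcont).sub ((hh.continuousOn_conj hopen).mono hV)
  obtain ⟨M, hM⟩ := (hVc.image_of_continuousOn hval).bddAbove
  have hsub : gradConjImage h V ⊆ {x | h x ≤ (M : EReal)} := by
    rw [hTeq]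
    rintro _ ⟨u, hu, rfl⟩
    have h1 := hM ⟨u, hu, rfl⟩
    have h2 := (hξ u (hV hu)).conj_eq hh
    rw [mem_ofPred_eq, ← hh.coe_toReal (hξ u (hV hu)).1]
    exact_mod_cast by linarith
  refine ⟨closure (primalHull h V), subset_closure, (convex_convexHull ℝ _).closure, ?_, ?_⟩
  · exact (isBounded_convexHull.2 hT.isBounded).isCompact_closure
  · intro x hx
    exact lt_of_le_of_lt (closure_minimal (convexHull_min hsub (hh.convex_sublevel M))
      (hh.isClosed_sublevel M) hx) (EReal.coe_lt_top M)

end ConjX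

/-! ### The modulus of strong convexity and smoothness of the conjugate -/

section Modulus

variable {X : Type*} [NormedAddCommGroup X] [NormedSpace ℝ X] {h : X → EReal}

/-- On a subset of a compact convex part of `dom h`, the infimum defining the modulus is positive and
bounds every quotient below, so it is itself a modulus of strong convexity. -/
lemma modulus_spec (hsc : LocallyStronglyConvex h) {S T : Set X} (hST : S ⊆ T)
    (hTconv : Convex ℝ T) (hTcomp : IsCompact T) (hTdom : T ⊆ effDom h) :
    0 < modulus h S ∧ ∀ x ∈ S, ∀ y ∈ S, ∀ t ∈ Ioo (0 : ℝ) 1,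
      modulus h S * (t * (1 - t) / 2 * ‖y - x‖ ^ 2) ≤
        t * (h x).toReal + (1 - t) * (h y).toReal - (h (t • x + (1 - t) • y)).toReal := by
  by_cases hS : S.Subsingleton
  · refine ⟨by simp [modulus, hS], fun x hx y hy t _ => ?_⟩
    rw [hS hy hx, ← add_smul, ← add_mul]
    simp
  obtain ⟨a, ha, b, hb, hab⟩ := not_subsingleton_iff.1 hS
  obtain ⟨m, hm, hstrong⟩ := hsc T ⟨a, hST ha⟩ hTconv hTcomp hTdom
  obtain ⟨-, hstrong⟩ := hstrong
  have hden : ∀ x y : X, x ≠ y → ∀ t ∈ Ioo (0 : ℝ) 1, 0 < t * (1 - t) / 2 * ‖y - x‖ ^ 2 := by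
    intro x y hxy t ht
    have h1 : 0 < ‖y - x‖ := norm_pos_iff.2 (sub_ne_zero.2 hxy.symm)
    have h2 : 0 < 1 - t := by linarith [ht.2]
    have h3 := ht.1
    positivity
  have hlow : ∀ x ∈ S, ∀ y ∈ S, ∀ t ∈ Ioo (0 : ℝ) 1, x ≠ y → m ≤
      (t * (h x).toReal + (1 - t) * (h y).toReal - (h (t • x + (1 - t) • y)).toReal) /
        (t * (1 - t) / 2 * ‖y - x‖ ^ 2) := by
    intro x hx y hy t ht hxy
    have h1 := hstrong (hST hx) (hST hy) ht.1.le (by linarith [ht.2] : 0 ≤ 1 - t) (by ring)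
    rw [le_div_iff₀ (hden x y hxy t ht), norm_sub_rev y x]
    simp only [smul_eq_mul] at h1
    linarith
  simp only [modulus, hS, if_false]
  constructor
  · refine lt_of_lt_of_le hm (le_csInf ?_ ?_)
    · exact ⟨_, a, ha, b, hb, 1 / 2, ⟨by norm_num, by norm_num⟩, hab, rfl⟩
    · rintro _ ⟨x, hx, y, hy, t, ht, hxy, rfl⟩
      exact hlow x hx y hy t ht hxy
  · intro x hx y hy t ht
    by_cases hxy : x = y
    · rw [hxy, ← add_smul, ← add_mul]
      simp
    · rw [← le_div_iff₀ (hden x y hxy t ht)]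
      refine csInf_le ⟨m, ?_⟩ ⟨x, hx, y, hy, t, ht, hxy, rfl⟩
      rintro _ ⟨x, hx, y, hy, t, ht, hxy, rfl⟩
      exact hlow x hx y hy t ht hxy

/-- Quadratic growth of `h - u` away from its minimizer. -/
lemma IsConjArgmax.growth (hh : ProperClosedConvex h) {m : ℝ} {u : StrongDual ℝ X} {x y : X}
    (hx : IsConjArgmax h u x) (hy : y ∈ effDom h)
    (hm : 0 ≤ m)
    (hstrong : ∀ t ∈ Ioo (0 : ℝ) 1, m * (t * (1 - t) / 2 * ‖x - y‖ ^ 2) ≤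
      t * (h y).toReal + (1 - t) * (h x).toReal - (h (t • y + (1 - t) • x)).toReal) :
    m / 2 * ‖x - y‖ ^ 2 ≤ (h y).toReal - (h x).toReal - u (y - x) := by
  set B := m / 2 * ‖x - y‖ ^ 2 with hB
  set D := (h y).toReal - (h x).toReal - u (y - x) with hD
  have key : ∀ t ∈ Ioo (0 : ℝ) 1, (1 - t) * B ≤ D := by
    intro t ht
    have h1 := hstrong t ht
    have h2 := hx.2 _ (hh.convex_effDom hy hx.1 ht.1.le (by linarith [ht.2] : 0 ≤ 1 - t) (by ring))
    simp only [map_add, map_smul, smul_eq_mul] at h2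
    have h3 : t * ((1 - t) * B) ≤ t * D := by
      rw [hB, hD, map_sub]
      nlinarith
    exact le_of_mul_le_mul_left h3 ht.1
  have hB0 : 0 ≤ B := by positivity
  by_contra! hlt
  have h1 := key (1 / 2) ⟨by norm_num, by norm_num⟩
  have hBpos : 0 < B := by linarith
  -- this value of `t` makes `(1 - t) * B` the midpoint of `D` and `B`
  have h2 := key ((B - D) / (2 * B)) ⟨by
    apply div_pos <;> linarith, by
    rw [div_lt_one (by linarith)]; linarith⟩
  have h3 : (1 - (B - D) / (2 * B)) * B = (B + D) / 2 := by field_simp; ring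
  linarith

/-- Descent inequality for `h*`, dual to the strong convexity of `h`. -/
lemma conj_le_of_strong (hh : ProperClosedConvex h) {S : Set X} {m : ℝ} (hm : 0 < m)
    (hstrong : ∀ x ∈ S, ∀ y ∈ S, ∀ t ∈ Ioo (0 : ℝ) 1, m * (t * (1 - t) / 2 * ‖y - x‖ ^ 2) ≤
      t * (h x).toReal + (1 - t) * (h y).toReal - (h (t • x + (1 - t) • y)).toReal)
    {u v : StrongDual ℝ X} {x y : X} (hx : IsConjArgmax h u x) (hy : IsConjArgmax h v y)
    (hxS : x ∈ S) (hyS : y ∈ S) :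
    (conj h v).toReal ≤ (conj h u).toReal + (v - u) x + ‖v - u‖ ^ 2 / (2 * m) := by
  have h1 := hx.growth hh hy.1 hm.le (hstrong y hyS x hxS)
  have h2 : (v - u) (y - x) ≤ ‖v - u‖ * ‖x - y‖ := by
    rw [norm_sub_rev x y]
    exact (Real.le_norm_self _).trans ((v - u).le_opNorm _)
  have h3 : ‖v - u‖ * ‖x - y‖ ≤ ‖v - u‖ ^ 2 / (2 * m) + m / 2 * ‖x - y‖ ^ 2 := by
    have h4 : ‖v - u‖ ^ 2 / (2 * m) + m / 2 * ‖x - y‖ ^ 2 - ‖v - u‖ * ‖x - y‖ =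
        (‖v - u‖ - m * ‖x - y‖) ^ 2 / (2 * m) := by field_simp; ring
    have : 0 ≤ (‖v - u‖ - m * ‖x - y‖) ^ 2 / (2 * m) := by positivity
    linarith
  rw [hx.conj_eq hh, hy.conj_eq hh]
  simp only [sub_apply, map_sub] at h1 h2 ⊢
  linarith

end Modulus

/-! ### The conjugate and the subdifferential of `f` -/

section ConjY

variable {Y : Type*} [NormedAddCommGroup Y] [NormedSpace ℝ Y] {f : StrongDual ℝ Y → ℝ}

lemma conjOfDual_ne_bot (y : Y) : conjOfDual f y ≠ ⊥ :=
  ne_bot_of_le_ne_bot (EReal.coe_ne_bot _)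
    (le_iSup (fun z : StrongDual ℝ Y => ((z y - f z : ℝ) : EReal)) 0)

lemma coe_toReal_conjOfDual {y : Y} (hy : y ∈ effDom (conjOfDual f)) :
    ((conjOfDual f y).toReal : EReal) = conjOfDual f y :=
  EReal.coe_toReal (ne_of_lt hy) (conjOfDual_ne_bot y)

lemma sub_le_conjOfDual {y : Y} (hy : y ∈ effDom (conjOfDual f)) (z : StrongDual ℝ Y) :
    z y - f z ≤ (conjOfDual f y).toReal := by
  have h1 := le_iSup (fun z : StrongDual ℝ Y => ((z y - f z : ℝ) : EReal)) z
  change _ ≤ conjOfDual f y at h1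
  rw [← coe_toReal_conjOfDual hy] at h1
  exact_mod_cast h1

lemma mem_dom_conjOfDual {y : Y} {c : ℝ} (hc : ∀ z : StrongDual ℝ Y, z y - f z ≤ c) :
    y ∈ effDom (conjOfDual f) ∧ (conjOfDual f y).toReal ≤ c := by
  have h1 : conjOfDual f y ≤ c := iSup_le fun z => by exact_mod_cast hc z
  have h2 : y ∈ effDom (conjOfDual f) := lt_of_le_of_lt h1 (EReal.coe_lt_top c)
  refine ⟨h2, ?_⟩
  rw [← coe_toReal_conjOfDual h2] at h1
  exact_mod_cast h1

lemma convexOn_conjOfDual :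
    ConvexOn ℝ (effDom (conjOfDual f)) (fun y => (conjOfDual f y).toReal) := by
  have key : ∀ u ∈ effDom (conjOfDual f), ∀ v ∈ effDom (conjOfDual f), ∀ a b : ℝ, 0 ≤ a → 0 ≤ b →
      a + b = 1 → ∀ z : StrongDual ℝ Y, z (a • u + b • v) - f z ≤
        a * (conjOfDual f u).toReal + b * (conjOfDual f v).toReal := by
    intro u hu v hv a b ha hb hab z
    have h1 := mul_le_mul_of_nonneg_left (sub_le_conjOfDual hu z) ha
    have h2 := mul_le_mul_of_nonneg_left (sub_le_conjOfDual hv z) hb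
    have h3 : f z = a * f z + b * f z := by rw [← add_mul, hab, one_mul]
    simp only [map_add, map_smul, smul_eq_mul]
    linarith
  refine ⟨fun u hu v hv a b ha hb hab => (mem_dom_conjOfDual (key u hu v hv a b ha hb hab)).1,
    fun u hu v hv a b ha hb hab => ?_⟩
  simpa using (mem_dom_conjOfDual (key u hu v hv a b ha hb hab)).2

/-- The equality case of the Fenchel–Young inequality. -/
lemma conjOfDual_of_mem_subdiff {z : StrongDual ℝ Y} {g : Y} (hg : g ∈ subdiff f z) :
    g ∈ effDom (conjOfDual f) ∧ (conjOfDual f g).toReal = z g - f z := by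
  have h1 := mem_dom_conjOfDual (f := f) (y := g) (c := z g - f z) fun z' => by
    have := hg z'
    rw [sub_apply] at this
    linarith
  exact ⟨h1.1, le_antisymm h1.2 (sub_le_conjOfDual h1.1 z)⟩

/-- `dom f*` is bounded by a Lipschitz constant of `f`. -/
lemma norm_le_of_mem_dom_conjOfDual {L : NNReal} (hfL : LipschitzWith L f) {y : Y}
    (hy : y ∈ effDom (conjOfDual f)) : ‖y‖ ≤ L := by
  by_contra! hlt
  obtain ⟨g, hg, hgy⟩ := exists_dual_vector'' ℝ y
  simp only [RCLike.ofReal_real_eq_id, id_eq] at hgy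
  set c := (conjOfDual f y).toReal
  have key : ∀ t : ℝ, 0 ≤ t → t * (‖y‖ - L) ≤ c + f 0 := by
    intro t ht
    have h1 := sub_le_conjOfDual hy (t • g)
    have h2 := hfL.dist_le_mul (t • g) 0
    rw [Real.dist_eq, dist_zero_right, norm_smul, Real.norm_of_nonneg ht] at h2
    have h3 := (le_abs_self _).trans h2
    have h4 : (L : ℝ) * (t * ‖g‖) ≤ L * (t * 1) := by gcongr
    rw [smul_apply, smul_eq_mul, hgy] at h1
    linarith
  have hpos : 0 < ‖y‖ - L := by linarith
  have h0 := key 0 le_rfl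
  have h1 := key ((c + f 0 + 1) / (‖y‖ - L)) (div_nonneg (by linarith) hpos.le)
  rw [div_mul_cancel₀ _ hpos.ne'] at h1
  linarith

/-- A finite-dimensional normed space is reflexive. -/
lemma exists_eval_eq [FiniteDimensional ℝ Y] (G : StrongDual ℝ (StrongDual ℝ Y)) :
    ∃ y : Y, ∀ z : StrongDual ℝ Y, G z = z y := by
  let b := Module.finBasis ℝ Y
  let c : Fin (Module.finrank ℝ Y) → StrongDual ℝ Y := fun i => (b.coord i).toContinuousLinearMap
  refine ⟨∑ i, G (c i) • b i, fun z => ?_⟩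
  have hz : z = ∑ i, z (b i) • c i := by
    ext w
    have h1 : z w = ∑ i, b.repr w i * z (b i) := by
      conv_lhs => rw [← b.sum_repr w, map_sum]
      simp only [map_smul, smul_eq_mul]
    rw [h1]
    simp [c, mul_comm]
  conv_lhs => rw [hz]
  simp [mul_comm]

/-- Subgradients exist everywhere: separate `(z, f z)` from the open strict epigraph of `f`. -/
lemma subdiff_nonempty [FiniteDimensional ℝ Y] (hf : ConvexOn ℝ univ f) {L : NNReal}
    (hfL : LipschitzWith L f) (z : StrongDual ℝ Y) : (subdiff f z).Nonempty := by
  have hconv : Convex ℝ {p : StrongDual ℝ Y × ℝ | f p.1 < p.2} := by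
    simpa using hf.convex_strict_epigraph
  have hop : IsOpen {p : StrongDual ℝ Y × ℝ | f p.1 < p.2} :=
    isOpen_lt (hfL.continuous.comp continuous_fst) continuous_snd
  obtain ⟨Φ, hΦ⟩ := geometric_hahn_banach_open_point (x := (z, f z)) hconv hop (by simp)
  set c := Φ (0, 1) with hcdef
  have hsplit : ∀ (w : StrongDual ℝ Y) (a : ℝ), Φ (w, a) = Φ (w, 0) + a * c := by
    intro w a
    have : ((w, a) : StrongDual ℝ Y × ℝ) = (w, 0) + a • (0, 1) := by simp
    rw [this, map_add, map_smul, smul_eq_mul]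
  have hc : c < 0 := by
    have h1 := hΦ (z, f z + 1) (by simp)
    rw [hsplit z (f z + 1), hsplit z (f z)] at h1
    linarith
  -- normalize the separating functional to have vertical component `-1`
  obtain ⟨y, hy⟩ := exists_eval_eq
    ((-c)⁻¹ • (Φ.comp (ContinuousLinearMap.inl ℝ (StrongDual ℝ Y) ℝ)))
  have hy' : ∀ w, (-c) * w y = Φ (w, 0) := by
    intro w
    rw [← hy w]
    simp only [smul_apply, ContinuousLinearMap.comp_apply, ContinuousLinearMap.inl_apply,
      smul_eq_mul]
    rw [mul_inv_cancel_left₀ (by linarith)]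
  refine ⟨y, fun z' => ?_⟩
  refine le_of_forall_pos_le_add fun ε hε => ?_
  have h1 := hΦ (z', f z' + ε) (by simpa using hε)
  rw [hsplit z' (f z' + ε), hsplit z (f z), ← hy', ← hy'] at h1
  have h2 : (-c) * (f z + (z' - z) y) < (-c) * (f z' + ε) := by
    rw [sub_apply]; linarith
  exact (lt_of_mul_lt_mul_left h2 (by linarith)).le

end ConjY

/-! ### Step sizes and the two recursions -/

lemma τ_eq (k : ℕ) : τ k = 2 / ((k : ℝ) + 2) := by
  simp only [τ, α, β]
  push_cast
  have : (k : ℝ) + 1 ≠ 0 := by positivity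
  field_simp
  ring

lemma τ_pos (k : ℕ) : 0 < τ k := by rw [τ_eq]; positivity

lemma τ_le_one (k : ℕ) : τ k ≤ 1 := by
  rw [τ_eq, div_le_one (by positivity)]
  linarith [(k.cast_nonneg : (0 : ℝ) ≤ k)]

lemma τ_antitone {j k : ℕ} (hjk : j ≤ k) : τ k ≤ τ j := by
  rw [τ_eq, τ_eq]
  have : (j : ℝ) ≤ k := by exact_mod_cast hjk
  gcongr

/-- Multiplying `e (k+1) ≤ (1 - τ k) e k + τ k² C` by `(k+1)(k+2)` makes the recursion telescope. -/
lemma mul_le_of_recursion {e : ℕ → ℝ} {C : ℝ} (hC : 0 ≤ C) {K : ℕ}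
    (he : ∀ k, K ≤ k → e (k + 1) ≤ (1 - τ k) * e k + τ k ^ 2 * C) {k : ℕ} (hk : K ≤ k) :
    (k : ℝ) * (k + 1) * e k ≤ (K : ℝ) * (K + 1) * e K + 4 * C * (k - K) := by
  induction k, hk using Nat.le_induction with
  | base => simp
  | succ k hk ih =>
    have h1 := mul_le_mul_of_nonneg_left (he k hk) (by positivity : (0 : ℝ) ≤ (k + 1) * (k + 2))
    have h2 : ((k : ℝ) + 1) * (k + 2) * ((1 - τ k) * e k + τ k ^ 2 * C) =
        k * (k + 1) * e k + 4 * C * (((k : ℝ) + 1) / (k + 2)) := by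
      rw [τ_eq]; field_simp; ring
    have h3 : 4 * C * (((k : ℝ) + 1) / (k + 2)) ≤ 4 * C * 1 := by
      gcongr
      rw [div_le_one (by positivity)]; linarith
    push_cast
    have h4 : ((k : ℝ) + 1 + 1) = k + 2 := by ring
    rw [h4]
    linarith

/-- Summing `δ (i+1) ≤ δ i - τ i G i + τ i² C` over the window `m ≤ i < k` bounds any common lower
bound `B` of the `G i`. -/
lemma le_of_window {δ G : ℕ → ℝ} {C B : ℝ} (hC : 0 ≤ C) (hB : 0 ≤ B) {m k : ℕ} (hmk : m < k)
    (hδ : ∀ i, 0 ≤ δ i)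
    (hstep : ∀ i, m ≤ i → δ (i + 1) ≤ δ i - τ i * G i + τ i ^ 2 * C)
    (hG : ∀ i, i < k → B ≤ G i) :
    B ≤ ((k : ℝ) + 1) / (2 * (k - m)) * δ m + 2 * C / (m + 1) := by
  have key : ∀ j, m ≤ j → j ≤ k →
      δ j ≤ δ m - B * (2 * (j - m) / (k + 1)) + 4 * C * (1 / (m + 1) - 1 / (j + 1)) := by
    intro j hj
    induction j, hj using Nat.le_induction with
    | base => intro _; simp
    | succ j hj ih =>
      intro hjk
      have h1 := ih (by omega)
      have h2 := hstep j hj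
      have hjk' : (j : ℝ) + 1 ≤ k := by exact_mod_cast hjk
      have h3 : B * (2 / ((k : ℝ) + 1)) ≤ τ j * G j := by
        rw [mul_comm (τ j), τ_eq]
        have := hG j (by omega)
        have h5 : 2 / ((k : ℝ) + 1) ≤ 2 / ((j : ℝ) + 2) :=
          div_le_div_of_nonneg_left (by norm_num) (by positivity) (by linarith)
        exact mul_le_mul this h5 (by positivity) (hB.trans this)
      have h4 : τ j ^ 2 * C ≤ 4 * C * (1 / ((j : ℝ) + 1) - 1 / ((j : ℝ) + 1 + 1)) := by
        have h6 : (1 / ((j : ℝ) + 1) - 1 / ((j : ℝ) + 1 + 1)) = 1 / (((j : ℝ) + 1) * (j + 2)) := by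
          field_simp; ring
        have h7 : τ j ^ 2 = 4 * (1 / (((j : ℝ) + 2) * (j + 2))) := by
          rw [τ_eq]; field_simp; norm_num
        rw [h6, h7]
        have h8 : 1 / (((j : ℝ) + 2) * (j + 2)) ≤ 1 / (((j : ℝ) + 1) * (j + 2)) := by
          gcongr; norm_num
        nlinarith
      have h9 : B * (2 * (((j : ℝ) + 1) - m) / (k + 1)) =
          B * (2 * ((j : ℝ) - m) / (k + 1)) + B * (2 / ((k : ℝ) + 1)) := by ring
      push_cast
      rw [h9]
      linarith
  have h1 := key k hmk.le le_rfl
  have h2 := hδ k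
  have hmk' : (0 : ℝ) < k - m := by
    have : (m : ℝ) < k := by exact_mod_cast hmk
    linarith
  have h3 : 0 ≤ δ m - B * (2 * (k - m) / (k + 1)) + 4 * C * (1 / (m + 1) - 1 / (k + 1)) :=
    h2.trans h1
  have h4 : ((k : ℝ) + 1) / (2 * (k - m)) * δ m + 2 * C / (m + 1) - B =
      ((k : ℝ) + 1) / (2 * (k - m)) *
        (δ m - B * (2 * (k - m) / (k + 1)) + 4 * C * (1 / (m + 1) - 1 / (k + 1))) := by
    field_simp
    ring
  have h5 := mul_nonneg (by positivity : 0 ≤ ((k : ℝ) + 1) / (2 * (k - m))) h3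
  linarith

/-- The rate for the smallest gap: apply the window bound to the second half of `[K, k)`, having
controlled `δ` at its left end by the telescoped recursion. -/
lemma exists_gap_le {δ G : ℕ → ℝ} {C : ℝ} (hC : 0 ≤ C) {K k : ℕ} (hKk : K + 1 ≤ k)
    (hδ : ∀ i, 0 ≤ δ i) (hδG : ∀ i, δ i ≤ G i)
    (hstep : ∀ i, K ≤ i → δ (i + 1) ≤ δ i - τ i * G i + τ i ^ 2 * C) :
    ∃ i < k, G i ≤ 12 * ((K : ℝ) + 1) ^ 2 / ((k - K) * (k + K)) * δ K + 52 * C / (k + K) := by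
  obtain ⟨i₀, hi₀, hmin⟩ := (Finset.range k).exists_min_image G ⟨0, by simp; omega⟩
  refine ⟨i₀, by simpa using hi₀, ?_⟩
  have hmin' : ∀ i, i < k → G i₀ ≤ G i := fun i hi => hmin i (by simpa using hi)
  have hB : 0 ≤ G i₀ := (hδ _).trans (hδG _)
  have hKk' : (K : ℝ) + 1 ≤ k := by exact_mod_cast hKk
  have hK0 : (0 : ℝ) ≤ K := K.cast_nonneg
  have hδK := hδ K
  set m := (K + k) / 2 with hm
  have hwin := le_of_window hC hB (m := m) (k := k) (by omega) hδ
    (fun i hi => hstep i (by omega)) hmin'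
  have hden : (0 : ℝ) < (k - K) * (k + K) := mul_pos (by linarith) (by linarith)
  refine hwin.trans ?_
  rcases Nat.lt_or_ge (K + 1) k with hlt | hge
  · have hm1 : (1 : ℝ) ≤ m := by exact_mod_cast (by omega : 1 ≤ m)
    have hm2 : (k : ℝ) + K ≤ 2 * m + 1 := by exact_mod_cast (by omega : k + K ≤ 2 * m + 1)
    have hm3 : 2 * (m : ℝ) ≤ k + K := by exact_mod_cast (by omega : 2 * m ≤ k + K)
    have hrec := mul_le_of_recursion hC (e := δ) (K := K) (fun i hi => by
      have h1 := hstep i hi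
      have h2 := mul_le_mul_of_nonneg_left (hδG i) (τ_pos i).le
      linarith) (by omega : K ≤ m)
    have hδm : δ m ≤ ((K : ℝ) * (K + 1) * δ K + 4 * C * (m - K)) / (m * (m + 1)) := by
      rw [le_div_iff₀ (by positivity)]; linarith
    have hkm : (0 : ℝ) < k - m := by linarith
    have e1 : ((k : ℝ) + 1) / (m + 1) ≤ 2 := by rw [div_le_iff₀ (by positivity)]; linarith
    have e2 : 1 / (2 * ((k : ℝ) - m)) ≤ 1 / (k - K) :=
      one_div_le_one_div_of_le (by linarith) (by linarith)
    have e3 : 1 / (m : ℝ) ≤ 3 / (k + K) := by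
      rw [div_le_div_iff₀ (by linarith) (by linarith)]; linarith
    have hmK : 0 ≤ (m : ℝ) - K := by
      have : (K : ℝ) ≤ m := by exact_mod_cast (by omega : K ≤ m)
      linarith
    have e4 : ((m : ℝ) - K) / (k - m) ≤ 1 := by rw [div_le_one hkm]; linarith
    have e5 : 2 * C / ((m : ℝ) + 1) ≤ 2 * C * (3 / (k + K)) := by
      rw [mul_div_assoc' (2 * C) 3, div_le_div_iff₀ (by linarith) (by linarith)]
      nlinarith
    have c1 : ((k : ℝ) + 1) / (m + 1) * (1 / (2 * (k - m))) * (1 / m) * (K * (K + 1)) ≤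
        2 * (1 / (k - K)) * (3 / (k + K)) * ((K + 1) * (K + 1)) := by
      have : 0 < (k : ℝ) - K := by linarith
      gcongr
      linarith
    have c2 : ((k : ℝ) + 1) / (m + 1) * (((m : ℝ) - K) / (k - m)) * (1 / m) * (2 * C) ≤
        2 * 1 * (3 / (k + K)) * (2 * C) := by
      gcongr
    calc ((k : ℝ) + 1) / (2 * (k - m)) * δ m + 2 * C / (m + 1)
        ≤ ((k : ℝ) + 1) / (2 * (k - m)) *
            (((K : ℝ) * (K + 1) * δ K + 4 * C * (m - K)) / (m * (m + 1))) + 2 * C / (m + 1) := by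
          gcongr
      _ = (((k : ℝ) + 1) / (m + 1) * (1 / (2 * (k - m))) * (1 / m) * (K * (K + 1))) * δ K +
          ((k : ℝ) + 1) / (m + 1) * (((m : ℝ) - K) / (k - m)) * (1 / m) * (2 * C) +
            2 * C / (m + 1) := by
          field_simp
          ring
      _ ≤ (2 * (1 / (k - K)) * (3 / (k + K)) * ((K + 1) * (K + 1))) * δ K +
          2 * 1 * (3 / (k + K)) * (2 * C) + 2 * C * (3 / (k + K)) := by
          gcongr
      _ ≤ 12 * ((K : ℝ) + 1) ^ 2 / ((k - K) * (k + K)) * δ K + 52 * C / (k + K) := by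
          have h1 : 2 * (1 / ((k : ℝ) - K)) * (3 / (k + K)) * ((K + 1) * (K + 1)) =
              6 * (((K : ℝ) + 1) ^ 2 / ((k - K) * (k + K))) := by
            have : (k : ℝ) - K ≠ 0 := by linarith
            have : (k : ℝ) + K ≠ 0 := by linarith
            field_simp
            norm_num
          have h2 : 2 * 1 * (3 / ((k : ℝ) + K)) * (2 * C) + 2 * C * (3 / (k + K)) =
              18 * (C / (k + K)) := by ring
          have h3 : 0 ≤ ((K : ℝ) + 1) ^ 2 / ((k - K) * (k + K)) * δ K := by positivity
          have h4 : 0 ≤ C / ((k : ℝ) + K) := div_nonneg hC (by linarith)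
          rw [add_assoc, h2, h1, mul_div_assoc 12, mul_div_assoc 52]
          linarith
  · have hk : k = K + 1 := by omega
    have hmK : m = K := by omega
    rw [hmK, hk]
    push_cast
    have a1 : ((K : ℝ) + 1 + 1) / (2 * (K + 1 - K)) ≤
        12 * ((K : ℝ) + 1) ^ 2 / ((K + 1 - K) * (K + 1 + K)) := by
      have h1 : (K : ℝ) + 1 - K = 1 := by ring
      rw [h1, div_le_div_iff₀ (by norm_num) (by positivity)]
      nlinarith
    have a2 : 2 * C / ((K : ℝ) + 1) ≤ 52 * C / (K + 1 + K) := by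
      rw [div_le_div_iff₀ (by positivity) (by positivity)]
      nlinarith
    have := mul_le_mul_of_nonneg_right a1 hδK
    linarith

/-! ### The primal and dual objectives -/

section Duality

variable {X Y : Type*} [NormedAddCommGroup X] [NormedSpace ℝ X]
  [NormedAddCommGroup Y] [NormedSpace ℝ Y]
  {f : StrongDual ℝ Y → ℝ} {h : X → EReal} {A : X →L[ℝ] StrongDual ℝ Y}

lemma mem_effDom_dual (hh : ProperClosedConvex h) {y : Y} :
    y ∈ effDom (dual f h A) ↔
      -(A.flip y) ∈ effDom (conj h) ∧ y ∈ effDom (conjOfDual f) := by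
  simp only [effDom, mem_ofPred_eq, dual, lt_top_iff_ne_top]
  exact EReal.add_ne_top_iff_ne_top₂ (hh.conj_ne_bot _) (conjOfDual_ne_bot _)

lemma coe_toReal_dual (hh : ProperClosedConvex h) {y : Y} (hy : y ∈ effDom (dual f h A)) :
    ((dual f h A y).toReal : EReal) = dual f h A y := by
  obtain ⟨h1, h2⟩ := (mem_effDom_dual hh).1 hy
  rw [dual, ← hh.coe_toReal_conj h1, ← coe_toReal_conjOfDual h2, ← EReal.coe_add, EReal.toReal_coe]

lemma toReal_dual (hh : ProperClosedConvex h) {y : Y} (hy : y ∈ effDom (dual f h A)) :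
    (dual f h A y).toReal = (conj h (-(A.flip y))).toReal + (conjOfDual f y).toReal := by
  obtain ⟨h1, h2⟩ := (mem_effDom_dual hh).1 hy
  rw [dual, ← hh.coe_toReal_conj h1, ← coe_toReal_conjOfDual h2, ← EReal.coe_add, EReal.toReal_coe,
    EReal.toReal_coe, EReal.toReal_coe]

lemma coe_primal (hh : ProperClosedConvex h) {x : X} (hx : x ∈ effDom h) :
    ((f (A x) + (h x).toReal : ℝ) : EReal) = primal f h A x := by
  rw [primal, ← hh.coe_toReal hx, EReal.coe_add, EReal.toReal_coe]

/-- Weak duality. -/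
lemma neg_primal_le_dual (hh : ProperClosedConvex h) {x : X} (hx : x ∈ effDom h) (y : Y) :
    ((-(f (A x) + (h x).toReal) : ℝ) : EReal) ≤ dual f h A y := by
  by_cases hy : y ∈ effDom (dual f h A)
  · obtain ⟨h1, h2⟩ := (mem_effDom_dual hh).1 hy
    have h3 := hh.sub_le_conj h1 hx
    have h4 := sub_le_conjOfDual h2 (A x)
    rw [← coe_toReal_dual hh hy, EReal.coe_le_coe_iff, toReal_dual hh hy]
    simp only [neg_apply, ContinuousLinearMap.flip_apply] at h3
    linarith
  · have : dual f h A y = ⊤ := by simpa [effDom] using hy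
    rw [this]
    exact le_top

lemma isProxMin_iff (hh : ProperClosedConvex h) {s : Y} {x : X} :
    IsProxMin h A s x ↔ IsConjArgmax h (-(A.flip s)) x := by
  constructor
  · intro hx
    have hxd : x ∈ effDom h := by
      obtain ⟨x', hx'⟩ := hh.nonempty_dom
      have h1 := hx x'
      rw [← hh.coe_toReal hx', ← EReal.coe_add] at h1
      by_contra hcon
      have : h x = ⊤ := by simpa [effDom] using hcon
      rw [this, EReal.coe_add_top] at h1
      exact absurd h1 (not_le.2 (EReal.coe_lt_top _))
    refine ⟨hxd, fun x' hx' => ?_⟩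
    have h1 := hx x'
    rw [← hh.coe_toReal hx', ← hh.coe_toReal hxd, ← EReal.coe_add, ← EReal.coe_add,
      EReal.coe_le_coe_iff] at h1
    simp only [neg_apply, ContinuousLinearMap.flip_apply]
    linarith
  · intro hx x'
    by_cases hx' : x' ∈ effDom h
    · have h1 := hx.2 x' hx'
      rw [← hh.coe_toReal hx', ← hh.coe_toReal hx.1, ← EReal.coe_add, ← EReal.coe_add,
        EReal.coe_le_coe_iff]
      simp only [neg_apply, ContinuousLinearMap.flip_apply] at h1
      linarith
    · have : h x' = ⊤ := by simpa [effDom] using hx'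
      rw [this, EReal.coe_add_top]
      exact le_top

variable {s0 : Y}

lemma isBounded_U {L : NNReal} (hfL : LipschitzWith L f) : Bornology.IsBounded (U f A) := by
  have h1 : Bornology.IsBounded (closure (effDom (conjOfDual f))) :=
    ((Metric.isBounded_closedBall (x := (0 : Y)) (r := (L : ℝ))).subset fun y hy => by
      simpa using norm_le_of_mem_dom_conjOfDual hfL hy).closure
  exact (-(A.flip)).lipschitz.isBounded_image h1

lemma isBounded_Ubar (hh : ProperClosedConvex h) {L : NNReal} (hfL : LipschitzWith L f)
    (hs0 : s0 ∈ effDom (dual f h A)) : Bornology.IsBounded (Ubar f h A s0) := by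
  have h1 : Bornology.IsBounded {y | dual f h A y ≤ dual f h A s0} :=
    (Metric.isBounded_closedBall (x := (0 : Y)) (r := (L : ℝ))).subset fun y hy => by
      have hle : dual f h A y ≤ dual f h A s0 := hy
      have hy' : y ∈ effDom (dual f h A) := hle.trans_lt hs0
      simpa using norm_le_of_mem_dom_conjOfDual hfL ((mem_effDom_dual hh).1 hy').2
  exact (-(A.flip)).lipschitz.isBounded_image h1

lemma norm_sub_le_ell (hh : ProperClosedConvex h) {L : NNReal} (hfL : LipschitzWith L f)
    (hs0 : s0 ∈ effDom (dual f h A)) {u u' : StrongDual ℝ X} (hu : u ∈ Ubar f h A s0)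
    (hu' : u' ∈ U f A) : ‖u - u'‖ ≤ ell f h A s0 := by
  refine le_csSup ?_ ⟨u, hu, u', hu', rfl⟩
  obtain ⟨a, ha⟩ := (isBounded_Ubar hh hfL hs0).exists_norm_le
  obtain ⟨b, hb⟩ := (isBounded_U (A := A) hfL).exists_norm_le
  refine ⟨a + b, ?_⟩
  rintro _ ⟨v, hv, v', hv', rfl⟩
  exact (norm_sub_le _ _).trans (add_le_add (ha v hv) (hb v' hv'))

/-! ### The burn-in length -/

/-- `τ k ≤ r / ℓ` as soon as `k ≥ 2 (ℓ / r - 1)`, and then the segment step stays within `r`. -/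
lemma mem_burnInSet_cthickening (hh : ProperClosedConvex h) {L : NNReal} (hfL : LipschitzWith L f)
    (hs0 : s0 ∈ effDom (dual f h A)) {r : ℝ} (hr : 0 < r) :
    2 * ⌈max (ell f h A s0 / r - 1) 0⌉₊ ∈
      burnInSet f h A s0 (Metric.cthickening r (Ubar f h A s0)) := by
  intro u hu u' hu'
  refine Metric.mem_cthickening_of_dist_le _ u _ _ hu ?_
  set n := ⌈max (ell f h A s0 / r - 1) 0⌉₊ with hn
  have h1 := norm_sub_le_ell hh hfL hs0 hu hu'
  have h2 : ell f h A s0 / r - 1 ≤ n := (le_max_left _ _).trans (Nat.le_ceil _)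
  have h3 : ell f h A s0 ≤ (n + 1) * r := by
    rw [← div_le_iff₀ hr]; linarith
  have h4 : (1 - τ (2 * n)) • u + τ (2 * n) • u' - u = τ (2 * n) • (u' - u) := by
    module
  rw [dist_eq_norm, h4, norm_smul, Real.norm_of_nonneg (τ_pos _).le, norm_sub_rev, τ_eq]
  push_cast
  rw [div_mul_eq_mul_div, div_le_iff₀ (by positivity)]
  linarith

lemma burnInSet_mono {V W : Set (StrongDual ℝ X)} (hVW : V ⊆ W) :
    burnInSet f h A s0 V ⊆ burnInSet f h A s0 W :=
  fun _ hk u hu u' hu' => hVW (hk u hu u' hu')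

/-- For convex `V ⊇ Ū`, shrinking the step keeps the point in `V`. -/
lemma mem_burnInSet_of_le {V : Set (StrongDual ℝ X)} (hV : Convex ℝ V)
    (hUV : Ubar f h A s0 ⊆ V) {j k : ℕ} (hj : j ∈ burnInSet f h A s0 V) (hjk : j ≤ k) :
    k ∈ burnInSet f h A s0 V := by
  intro u hu u' hu'
  have hpos := τ_pos j
  have hle : τ k / τ j ≤ 1 := (div_le_one hpos).2 (τ_antitone hjk)
  have h1 := hV (hUV hu) (hj u hu u' hu') (sub_nonneg.2 hle)
    (div_nonneg (τ_pos k).le hpos.le) (by ring)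
  have h2 : (1 - τ k / τ j) • u + (τ k / τ j) • ((1 - τ j) • u + τ j • u') =
      (1 - τ k) • u + τ k • u' := by
    have h3 : τ k / τ j * τ j = τ k := div_mul_cancel₀ _ hpos.ne'
    rw [smul_add, smul_smul, smul_smul, ← add_assoc, ← add_smul, mul_sub, h3]
    congr 2
    ring
  rwa [h2] at h1

/-! ### Runs of the method -/

section Run

variable {s : ℕ → Y} {x : ℕ → X} {g : ℕ → Y}

lemma IsRun.invariant (hrun : IsRun f h A s0 s x g) (k : ℕ) :
    IsProxMin h A (s k) (x k) ∧ g k ∈ subdiff f (A (x k)) := by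
  induction k with
  | zero => exact ⟨hrun.x_zero, hrun.g_zero⟩
  | succ k ih =>
    by_cases hk : dual f h A ((1 - τ k) • s k + τ k • g k) < dual f h A (s k)
    · exact (hrun.active k hk).2
    · obtain ⟨h1, h2, h3⟩ := hrun.idle k hk
      rwa [h1, h2, h3]

lemma IsRun.dual_succ_le (hrun : IsRun f h A s0 s x g) (k : ℕ) :
    dual f h A (s (k + 1)) ≤ dual f h A (s k) ∧
      dual f h A (s (k + 1)) ≤ dual f h A ((1 - τ k) • s k + τ k • g k) := by
  by_cases hk : dual f h A ((1 - τ k) • s k + τ k • g k) < dual f h A (s k)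
  · rw [(hrun.active k hk).1]
    exact ⟨hk.le, le_rfl⟩
  · rw [(hrun.idle k hk).1]
    exact ⟨le_rfl, not_lt.1 hk⟩

lemma IsRun.dual_le (hrun : IsRun f h A s0 s x g) (k : ℕ) :
    dual f h A (s k) ≤ dual f h A s0 := by
  induction k with
  | zero => rw [hrun.s_zero]
  | succ k ih => exact (hrun.dual_succ_le k).1.trans ih

/-- One step of the method decreases `D` by `τ k` times the primal-dual gap, up to the second-order
term of the descent inequality for `h*`. -/
lemma IsRun.dual_succ_le_sub_gap (hrun : IsRun f h A s0 s x g) (hh : ProperClosedConvex h)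
    {L : NNReal} (hfL : LipschitzWith L f) (hs0 : s0 ∈ effDom (dual f h A))
    {V : Set (StrongDual ℝ X)} (hVdom : V ⊆ effDom (conj h)) {m : ℝ} (hm : 0 < m)
    (hsmooth : ∀ u ∈ V, ∀ v ∈ V, ∀ x, IsConjArgmax h u x →
      (conj h v).toReal ≤ (conj h u).toReal + (v - u) x + ‖v - u‖ ^ 2 / (2 * m))
    (hUV : Ubar f h A s0 ⊆ V) {k : ℕ} (hk : k ∈ burnInSet f h A s0 V) :
    (dual f h A (s (k + 1))).toReal ≤ (dual f h A (s k)).toReal -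
      τ k * (f (A (x k)) + (h (x k)).toReal + (dual f h A (s k)).toReal) +
        τ k ^ 2 * (ell f h A s0 ^ 2 / (2 * m)) := by
  obtain ⟨hx, hg⟩ := hrun.invariant k
  rw [isProxMin_iff hh] at hx
  obtain ⟨hgd, hgv⟩ := conjOfDual_of_mem_subdiff hg
  have hsk : s k ∈ effDom (dual f h A) := lt_of_le_of_lt (hrun.dual_le k) hs0
  have hsk1 : s (k + 1) ∈ effDom (dual f h A) := lt_of_le_of_lt (hrun.dual_le _) hs0
  obtain ⟨-, hskf⟩ := (mem_effDom_dual hh).1 hsk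
  have hu : -(A.flip (s k)) ∈ Ubar f h A s0 := ⟨s k, hrun.dual_le k, rfl⟩
  have hu' : -(A.flip (g k)) ∈ U f A := ⟨g k, subset_closure hgd, rfl⟩
  have hv := hk _ hu _ hu'
  have hveq : (1 - τ k) • -(A.flip (s k)) + τ k • -(A.flip (g k)) =
      -(A.flip ((1 - τ k) • s k + τ k • g k)) := by
    rw [map_add, map_smul, map_smul, smul_neg, smul_neg, neg_add]
  rw [hveq] at hv
  have hc := convexOn_conjOfDual (f := f)
  have ht1 : 0 ≤ 1 - τ k := sub_nonneg.2 (τ_le_one k)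
  have hcf := hc.2 hskf hgd ht1 (τ_pos k).le (by ring)
  have hhat : (1 - τ k) • s k + τ k • g k ∈ effDom (dual f h A) :=
    (mem_effDom_dual hh).2 ⟨hVdom hv, hc.1 hskf hgd ht1 (τ_pos k).le (by ring)⟩
  have h1 := (hrun.dual_succ_le k).2
  rw [← coe_toReal_dual hh hsk1, ← coe_toReal_dual hh hhat, EReal.coe_le_coe_iff,
    toReal_dual hh hhat] at h1
  have h2 := hsmooth _ (hUV hu) _ hv _ hx
  have hdiff : -(A.flip ((1 - τ k) • s k + τ k • g k)) - -(A.flip (s k)) =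
      τ k • (-(A.flip (g k)) - -(A.flip (s k))) := by
    rw [← hveq, sub_smul, one_smul, smul_sub]; abel
  have hnorm : ‖-(A.flip ((1 - τ k) • s k + τ k • g k)) - -(A.flip (s k))‖ ^ 2 / (2 * m) ≤
      τ k ^ 2 * (ell f h A s0 ^ 2 / (2 * m)) := by
    have h3 := norm_sub_le_ell hh hfL hs0 hu hu'
    rw [hdiff, norm_smul, Real.norm_of_nonneg (τ_pos k).le, norm_sub_rev, mul_pow, mul_div_assoc]
    gcongr
  have hlin : (-(A.flip ((1 - τ k) • s k + τ k • g k)) - -(A.flip (s k))) (x k) =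
      τ k * (A (x k) (s k) - A (x k) (g k)) := by
    rw [hdiff]
    simp only [smul_apply, sub_apply, neg_apply, ContinuousLinearMap.flip_apply, smul_eq_mul]
    ring
  have hxv := hx.conj_eq hh
  simp only [neg_apply, ContinuousLinearMap.flip_apply] at hxv
  simp only [smul_eq_mul] at hcf
  rw [toReal_dual hh hsk]
  rw [hlin] at h2
  have hgap : τ k * (f (A (x k)) + (h (x k)).toReal +
      ((conj h (-(A.flip (s k)))).toReal + (conjOfDual f (s k)).toReal)) =
      τ k * (A (x k) (g k) - A (x k) (s k)) + τ k * (conjOfDual f (s k)).toReal -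
        τ k * (conjOfDual f (g k)).toReal := by
    rw [hgv, hxv]; ring
  rw [hgap]
  linarith

end Run

/-- The method can be run from any point of `dom D`: the subproblems have solutions because
`dom h*` is open, and `f` has subgradients everywhere. -/
lemma exists_isRun [FiniteDimensional ℝ X] [FiniteDimensional ℝ Y] (hf : ConvexOn ℝ univ f)
    {L : NNReal} (hfL : LipschitzWith L f) (hh : ProperClosedConvex h)
    (hopen : IsOpen (effDom (conj h))) (hs0 : s0 ∈ effDom (dual f h A)) :
    ∃ (s : ℕ → Y) (x : ℕ → X) (g : ℕ → Y), IsRun f h A s0 s x g := by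
  classical
  have hex : ∀ s : Y, ∃ p : X × Y, s ∈ effDom (dual f h A) →
      IsProxMin h A s p.1 ∧ p.2 ∈ subdiff f (A p.1) := by
    intro s
    by_cases hs : s ∈ effDom (dual f h A)
    · obtain ⟨x, hx⟩ := hh.exists_argmax hopen ((mem_effDom_dual hh).1 hs).1
      obtain ⟨g, hg⟩ := subdiff_nonempty hf hfL (A x)
      exact ⟨(x, g), fun _ => ⟨(isProxMin_iff hh).2 hx, hg⟩⟩
    · exact ⟨0, fun h => absurd h hs⟩
  choose p hp using hex
  let hat : ℕ → Y → Y := fun k s => (1 - τ k) • s + τ k • (p s).2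
  let next : ℕ → Y → Y := fun k s => if dual f h A (hat k s) < dual f h A s then hat k s else s
  let s : ℕ → Y := fun n => Nat.rec s0 next n
  have hs : ∀ k, s (k + 1) = next k (s k) := fun _ => rfl
  refine ⟨s, fun k => (p (s k)).1, fun k => (p (s k)).2, rfl, (hp s0 hs0).1, (hp s0 hs0).2, ?_, ?_⟩
  · intro k hk
    have h1 : s (k + 1) = hat k (s k) := by rw [hs]; exact if_pos hk
    have h2 : s (k + 1) ∈ effDom (dual f h A) := by
      rw [h1]; exact lt_of_lt_of_le hk le_top
    exact ⟨h1, hp _ h2⟩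
  · intro k hk
    have h1 : s (k + 1) = s k := by rw [hs]; exact if_neg hk
    exact ⟨h1, by simp only [h1], by simp only [h1]⟩

end Duality

end DualAveraging

/-! ### The convergence rates -/

open DualAveraging

theorem mainTheorem2
    {X Y : Type*}
    [NormedAddCommGroup X] [NormedSpace ℝ X] [FiniteDimensional ℝ X]
    [NormedAddCommGroup Y] [NormedSpace ℝ Y] [FiniteDimensional ℝ Y]
    (f : StrongDual ℝ Y → ℝ) (h : X → EReal) (A : X →L[ℝ] StrongDual ℝ Y)
    (hf : ConvexOn ℝ Set.univ f) (L : NNReal) (hfL : LipschitzWith L f)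
    (hh : DualAveraging.ProperClosedConvex h)
    (hP : ⊥ < ⨅ x : X, DualAveraging.primal f h A x)
    (hsc : DualAveraging.LocallyStronglyConvex h)
    (hopen : IsOpen (DualAveraging.effDom (DualAveraging.conj h)))
    (s0 : Y) (hs0 : s0 ∈ DualAveraging.effDom (DualAveraging.dual f h A))
    (r : ℝ) (hr : 0 < r) (hrΔ : ENNReal.ofReal r < DualAveraging.Delta f h A s0)
    (V : Set (StrongDual ℝ X)) (hVconv : Convex ℝ V) (hVcomp : IsCompact V)
    (hVsub : Metric.cthickening r (DualAveraging.Ubar f h A s0) ⊆ V)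
    (hVdom : V ⊆ DualAveraging.effDom (DualAveraging.conj h))
    (K : ℕ) (hK : K = DualAveraging.burnIn f h A s0 V)
    (ℓ : ℝ) (hℓ : ℓ = DualAveraging.ell f h A s0)
    (μ : ℝ) (hμ : μ = DualAveraging.modulus h (DualAveraging.primalHull h V)) :
    -- the burn-in lengths are well defined, with their upper bound
    ((DualAveraging.burnInSet f h A s0 V).Nonempty ∧
      (DualAveraging.burnInSet f h A s0
        (Metric.cthickening r (DualAveraging.Ubar f h A s0))).Nonempty ∧
      K ≤ DualAveraging.burnIn f h A s0
        (Metric.cthickening r (DualAveraging.Ubar f h A s0)) ∧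
      DualAveraging.burnIn f h A s0
        (Metric.cthickening r (DualAveraging.Ubar f h A s0)) ≤ 2 * ⌈max (ℓ / r - 1) 0⌉₊) ∧
    -- the constants in the rates are meaningful
    0 < μ ∧
    -- the method can be run from `s0`
    (∃ (s : ℕ → Y) (x : ℕ → X) (g : ℕ → Y), DualAveraging.IsRun f h A s0 s x g) ∧
    -- guarantees for every run
    (∀ (s : ℕ → Y) (x : ℕ → X) (g : ℕ → Y), DualAveraging.IsRun f h A s0 s x g →
      (∀ k, DualAveraging.dual f h A (s (k + 1)) ≤ DualAveraging.dual f h A (s k)) ∧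
      (∀ k, 1 ≤ k → k ≤ K → DualAveraging.dual f h A (s k) ≤ DualAveraging.dual f h A (s 0)) ∧
      (∀ k : ℕ, K + 1 ≤ k →
        (⨅ i ∈ Finset.range k,
            (DualAveraging.primal f h A (x i) + DualAveraging.dual f h A (s i))) ≤
          ((12 * ((K : ℝ) + 1) ^ 2 / (((k : ℝ) - K) * ((k : ℝ) + K)) : ℝ) : EReal) *
              (DualAveraging.dual f h A (s K) - DualAveraging.dualOpt f h A) +
            ((26 * ℓ ^ 2 / (μ * ((k : ℝ) + K)) : ℝ) : EReal)) ∧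
      (∀ xhat : ℕ → X,
        (∀ k, (∃ j ≤ k, xhat k = x j) ∧
          ∀ j ≤ k, DualAveraging.primal f h A (xhat k) ≤ DualAveraging.primal f h A (x j)) →
        ∀ k : ℕ, K + 1 ≤ k →
          DualAveraging.primal f h A (xhat k) + DualAveraging.dual f h A (s k) ≤
            (((K : ℝ) * ((K : ℝ) + 1) / ((k : ℝ) * ((k : ℝ) + 1)) : ℝ) : EReal) *
                (DualAveraging.primal f h A (xhat K) + DualAveraging.dual f h A (s K)) +
              ((2 * ℓ ^ 2 * ((k : ℝ) - K) / (μ * ((k : ℝ) * ((k : ℝ) + 1))) : ℝ) : EReal))) := by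
  have hbd := mem_burnInSet_cthickening (A := A) (s0 := s0) hh hfL hs0 hr
  have hbdV := burnInSet_mono hVsub hbd
  have hUV : Ubar f h A s0 ⊆ V := (Metric.self_subset_cthickening _).trans hVsub
  have hKmem : K ∈ burnInSet f h A s0 V := hK ▸ Nat.sInf_mem ⟨_, hbdV⟩
  obtain ⟨S, hST, hSconv, hScomp, hSdom⟩ :=
    exists_compact_primalHull_subset hh hopen hsc hVcomp hVdom
  obtain ⟨hμpos, hμstr⟩ := modulus_spec hsc hST hSconv hScomp hSdom
  rw [← hμ] at hμpos hμstr
  have hmem : ∀ u ∈ V, ∀ x, IsConjArgmax h u x → x ∈ primalHull h V := fun u hu x hx =>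
    subset_convexHull ℝ _ ((gradConjImage_eq hh hopen hsc hVdom).symm ▸ ⟨u, hu, hx⟩)
  have hsmooth : ∀ u ∈ V, ∀ v ∈ V, ∀ x, IsConjArgmax h u x →
      (conj h v).toReal ≤ (conj h u).toReal + (v - u) x + ‖v - u‖ ^ 2 / (2 * μ) := by
    intro u hu v hv x hx
    obtain ⟨y, hy⟩ := hh.exists_argmax hopen (hVdom hv)
    exact conj_le_of_strong hh hμpos hμstr hx hy (hmem u hu x hx) (hmem v hv y hy)
  refine ⟨⟨⟨_, hbdV⟩, ⟨_, hbd⟩, ?_, Nat.sInf_le (hℓ ▸ hbd)⟩, hμpos,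
    exists_isRun hf hfL hh hopen hs0, ?_⟩
  · rw [hK]
    exact Nat.sInf_le (burnInSet_mono hVsub (Nat.sInf_mem ⟨_, hbd⟩))
  intro s x g hrun
  have hD : ∀ k, s k ∈ effDom (dual f h A) := fun k => (hrun.dual_le k).trans_lt hs0
  have hxd : ∀ k, x k ∈ effDom h := fun k => ((isProxMin_iff hh).1 (hrun.invariant k).1).1
  set d : ℕ → ℝ := fun k => (dual f h A (s k)).toReal
  set p : X → ℝ := fun x => f (A x) + (h x).toReal
  set C : ℝ := ℓ ^ 2 / (2 * μ) with hCdef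
  have hC : 0 ≤ C := by positivity
  have hdc : ∀ k, dual f h A (s k) = (d k : EReal) := fun k => (coe_toReal_dual hh (hD k)).symm
  have hpc : ∀ k, primal f h A (x k) = (p (x k) : EReal) := fun k => (coe_primal hh (hxd k)).symm
  have hstep : ∀ k, K ≤ k → d (k + 1) ≤ d k - τ k * (p (x k) + d k) + τ k ^ 2 * C := by
    intro k hk
    have := hrun.dual_succ_le_sub_gap hh hfL hs0 hVdom hμpos hsmooth hUV
      (mem_burnInSet_of_le hVconv hUV hKmem hk)
    rwa [← hℓ] at this
  refine ⟨fun k => (hrun.dual_succ_le k).1, fun k _ _ => hrun.s_zero.symm ▸ hrun.dual_le k, ?_, ?_⟩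
  · intro k hk
    -- the dual optimal value is real: weak duality bounds it below, `D s₀` above
    have hlow : ∀ i, ((-p (x i) : ℝ) : EReal) ≤ dualOpt f h A :=
      fun i => le_iInf fun y => neg_primal_le_dual hh (hxd i) y
    have hupp : ∀ i, dualOpt f h A ≤ (d i : EReal) := fun i => hdc i ▸ iInf_le _ (s i)
    have hopt : ((dualOpt f h A).toReal : EReal) = dualOpt f h A :=
      EReal.coe_toReal (ne_of_lt ((hupp 0).trans_lt (EReal.coe_lt_top _)))
        (ne_bot_of_le_ne_bot (EReal.coe_ne_bot _) (hlow 0))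
    set o : ℝ := (dualOpt f h A).toReal
    rw [← hopt] at hlow hupp ⊢
    simp only [EReal.coe_le_coe_iff] at hlow hupp
    obtain ⟨i, hik, hi⟩ := exists_gap_le (δ := fun i => d i - o) (G := fun i => p (x i) + d i) hC hk
      (fun i => sub_nonneg.2 (hupp i)) (fun i => by linarith [hlow i])
      (fun i hi => by linarith [hstep i hi])
    refine (iInf₂_le i (Finset.mem_range.2 hik)).trans ?_
    rw [hpc, hdc, hdc, ← EReal.coe_sub, ← EReal.coe_mul, ← EReal.coe_add, ← EReal.coe_add,
      EReal.coe_le_coe_iff]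
    have h52 : 52 * C / ((k : ℝ) + K) = 26 * ℓ ^ 2 / (μ * (k + K)) := by
      rw [hCdef]; field_simp; ring
    rwa [h52] at hi
  · intro xhat hxhat k hk
    have hxhatd : ∀ k, xhat k ∈ effDom h := fun k => by
      obtain ⟨j, -, hj⟩ := (hxhat k).1
      exact hj ▸ hxd j
    have hpc' : ∀ k, primal f h A (xhat k) = (p (xhat k) : EReal) :=
      fun k => (coe_primal hh (hxhatd k)).symm
    have hbest : ∀ k, ∀ j ≤ k, p (xhat k) ≤ p (x j) := fun k j hj => by
      have := (hxhat k).2 j hj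
      rw [hpc', hpc] at this
      exact_mod_cast this
    have hmono : ∀ k, p (xhat (k + 1)) ≤ p (xhat k) := fun k => by
      obtain ⟨j, hj, hxj⟩ := (hxhat k).1
      rw [hxj]
      exact hbest _ j (by omega)
    have hrec := mul_le_of_recursion hC (e := fun k => p (xhat k) + d k) (K := K) (fun i hi => by
      have h1 := hstep i hi
      have h2 := mul_le_mul_of_nonneg_left (hbest i i le_rfl) (τ_pos i).le
      have h3 := hmono i
      linarith) (by omega : K ≤ k)
    have hk0 : (0 : ℝ) < k := by exact_mod_cast (by omega : 0 < k)
    rw [hpc', hpc', hdc, hdc, ← EReal.coe_add, ← EReal.coe_add, ← EReal.coe_mul, ← EReal.coe_add,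
      EReal.coe_le_coe_iff]
    have h1 : (K : ℝ) * (K + 1) / (k * (k + 1)) * (p (xhat K) + d K) +
        2 * ℓ ^ 2 * (k - K) / (μ * (k * (k + 1))) =
        (K * (K + 1) * (p (xhat K) + d K) + 4 * C * (k - K)) / (k * (k + 1)) := by
      rw [hCdef]; field_simp; ring
    rw [h1, le_div_iff₀ (by positivity)]
    linarith
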